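/- Let $1\le K\le N$ and $d$ be integers, let $X_1,\dots,X_N$ be random vectors in $\mathbb R^d$ on a common probability space, and let $\{1,\dots,N\}=\mathcal I\cup\mathcal O$ be a (deterministic) partition such that nothing is assumed on $(X_i)_{i\in\mathcal O}$ (the outliers), while the $(X_i)_{i\in\mathcal I}$ (the informative data) are independent, have finite second moments, common mean $\mu\in\mathbb R^d$, and satisfy $\mathbb E[(X_i-\mu)(X_i-\mu)^\top]\preceq\Sigma$ for a fixed covariance (symmetric positive semidefinite) matrix $\Sigma\in\mathbb R^{d\times d}$. Split the data into $K$ disjoint blocks $B_1,\dots,B_K\subset\{1,\dots,N\}$ of equal size $\lfloor N/K\rfloor$ (so of size $N/K$ if $K$ divides $N$; otherwise the remaining points are discarded). The split is either fixed or random and independent of $(X_i)_{i\in\mathcal I}$. Let $\bar X_k=\frac1{|B_k|}\sum_{i\in B_k}X_i$, and let $$r=1200\sqrt{\frac{\operatorname{Tr}(\Sigma)}{N}}+\sqrt{\frac{1200\,\|\Sigma\|_{op}\,K}{N}},$$ where $\|\Sigma\|_{op}$ is the operator norm with respect to the Euclidean norm. If $K\ge 300|\mathcal O|$, then with probability at least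 $1-\exp(-K/180000)$ the following holds simultaneously for all symmetric positive semidefinite matrices $M\in\mathbb R^{d\times d}$ with $\operatorname{Tr}(M)=1$: at least $9K/10$ of the indices $k\in\{1,\dots,K\}$ satisfy $\|M^{1/2}(\bar X_k-\mu)\|_2\le 8r$. -/

import Mathlib

open MeasureTheory ProbabilityTheory
open scoped MatrixOrder

/-- A split of the data set `{1, …, N}` into `K` disjoint blocks of equal size. The size is
`⌊N / K⌋`, so exactly `N / K` if `K` divides `N`; otherwise the points lying in no block are the
ones that have been removed. -/
structure BlockSplit (N K : ℕ) where
  block : Fin K → Finset (Fin N)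
  disjoint : Pairwise fun k l => Disjoint (block k) (block l)
  card_block : ∀ k, (block k).card = N / K

/-- There are finitely many splits, and all sets of splits are measurable. -/
instance BlockSplit.instMeasurableSpace (N K : ℕ) : MeasurableSpace (BlockSplit N K) := ⊤

/-- The empirical mean `(1 / |B_k|) ∑_{i ∈ B_k} x_i` of the data `x` over the `k`-th block. -/
noncomputable def blockMean {N K d : ℕ} (B : BlockSplit N K)
    (x : Fin N → EuclideanSpace ℝ (Fin d)) (k : Fin K) : EuclideanSpace ℝ (Fin d) :=
  ((B.block k).card : ℝ)⁻¹ • ∑ i ∈ B.block k, x i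

/-- The matrix `E[(Y - μ)(Y - μ)ᵀ]`. -/
noncomputable def secondMomentAbout {Ω : Type*} [MeasurableSpace Ω] {d : ℕ} (P : Measure Ω)
    (Y : Ω → EuclideanSpace ℝ (Fin d)) (μ : EuclideanSpace ℝ (Fin d)) :
    Matrix (Fin d) (Fin d) ℝ :=
  Matrix.of fun a b => ∫ ω, (Y ω a - μ a) * (Y ω b - μ b) ∂P

/-- The data `X_1, …, X_N` are contaminated: nothing at all is assumed on those with index in `O`,
and the others (the informative data) are independent random vectors with a second moment, with
mean `μ` and with covariance matrix `⪯ S` in the Loewner order. -/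
structure ContaminatedSample {Ω : Type*} [MeasurableSpace Ω] {N d : ℕ} (P : Measure Ω)
    (X : Fin N → Ω → EuclideanSpace ℝ (Fin d)) (O : Finset (Fin N))
    (μ : EuclideanSpace ℝ (Fin d)) (S : Matrix (Fin d) (Fin d) ℝ) : Prop where
  measurable : ∀ i ∉ O, Measurable (X i)
  indep : iIndepFun (fun i : {i // i ∉ O} => X i) P
  memLp : ∀ i ∉ O, MemLp (X i) 2 P
  mean : ∀ i ∉ O, ∫ ω, X i ω ∂P = μ
  cov_le : ∀ i ∉ O, secondMomentAbout P (X i) μ ≤ S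

/-- `r = 1200 √(Tr S / N) + √(1200 ‖S‖ K / N)`, where `‖S‖` is the operator norm of `S` on
Euclidean space. -/
noncomputable def rate {d : ℕ} (N K : ℕ) (S : Matrix (Fin d) (Fin d) ℝ) : ℝ :=
  1200 * Real.sqrt (S.trace / N) +
    Real.sqrt (1200 * ‖Matrix.toEuclideanCLM (n := Fin d) (𝕜 := ℝ) S‖ * K / N)

/-- The property of the data `x` that defines the good event: for every positive semidefinite `M` of
trace one, at least `9 K / 10` of the blocks satisfy `‖M^{1/2} (X̄_k - μ)‖₂ ≤ 8 r`. -/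
def GoodBlocks {N K d : ℕ} (B : BlockSplit N K) (x : Fin N → EuclideanSpace ℝ (Fin d))
    (μ : EuclideanSpace ℝ (Fin d)) (r : ℝ) : Prop :=
  ∀ M : Matrix (Fin d) (Fin d) ℝ, M.PosSemidef → M.trace = 1 →
    (9 / 10 : ℝ) * K ≤
      ({k : Fin K | ‖Matrix.toEuclideanCLM (n := Fin d) (𝕜 := ℝ) (CFC.sqrt M)
          (blockMean B x k - μ)‖ ≤ 8 * r}.ncard : ℝ)

/-!
The proof is a PAC-Bayes argument; no symmetrization or contraction is needed, and second moments
suffice because only the indicators `1{|⟨Z_k, w⟩| > R}` are exponentiated. Here `Z_k` (`cleanMean`)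
is the centred mean of the `k`-th block computed from the informative data only; it differs from
`X̄_k - μ` for at most `|O| ≤ K / 300` blocks.

For a fixed direction `w`, Chebyshev's inequality and the independence of the blocks bound the
exponential moment of the number of `k` with `|⟨Z_k, w⟩| > R`, suitably compensated
(`ContaminatedSample.lintegral_exp_exceedances_le`). Averaging over a standard Gaussian `w` and
over the random split, and then using Markov's inequality, gives an event of probability at least
`1 - exp (-K / 180000)`. It is measurable by construction, since no supremum is taken. On that
event the change of measure from the Gaussian to its translate by `u = √β v`
(`integral_shift_le_of_lintegral_exp_le`) bounds the mean number of exceedances under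
`w = g + u`, at the price `β / 2`, simultaneously for all unit vectors `v`. By the symmetry of `g`,
a block with `|⟨Z_k, u⟩| > R` is an exceedance for `w` with probability at least one half. With
`β = K / 500` and `R = √β r`, at most `K / 90` blocks satisfy `|⟨Z_k, v⟩| > r`
(`card_cleanMean_large_le`).

To pass from directions to density matrices `M = ∑ λ_j e_j e_jᵀ`, consider the random unit vectors
`∑ ± √λ_j e_j`. If `‖M^{1/2} z‖ > 8 r`, the Paley–Zygmund inequality shows that a proportion at
least `3 / 10` of these vectors `v` satisfy `|⟨z, v⟩| > r`; averaging over the signs bounds the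
number of bad blocks by `(10 / 3) (K / 90 + K / 300) ≤ K / 10` (`card_norm_sqrt_large_le`).
-/

/-! ### Rademacher sums and rounding of density matrices -/

/-- The signed sum `∑_{j ∈ s} ± a_j`, where the sign is `+` exactly for `j ∈ t`. Letting `t` range
over the subsets of `s` enumerates all choices of signs. -/
def signedSum {ι : Type*} [DecidableEq ι] (a : ι → ℝ) (s t : Finset ι) : ℝ :=
  ∑ j ∈ s, if j ∈ t then a j else -a j

section Signs

variable {ι : Type*} [DecidableEq ι] (a : ι → ℝ)

lemma signedSum_insert_right {i : ι} {s t : Finset ι} (hi : i ∉ s) :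
    signedSum a (insert i s) (insert i t) = signedSum a s t + a i := by
  rw [signedSum, Finset.sum_insert hi, signedSum, if_pos (Finset.mem_insert_self _ _), add_comm]
  congr 1
  refine Finset.sum_congr rfl fun j hj => ?_
  have : j ≠ i := fun h => hi (h ▸ hj)
  simp [this]

lemma signedSum_insert_left {i : ι} {s t : Finset ι} (hi : i ∉ s) (ht : t ⊆ s) :
    signedSum a (insert i s) t = signedSum a s t - a i := by
  rw [signedSum, Finset.sum_insert hi, signedSum, if_neg fun h => hi (ht h)]
  ring

lemma sum_signedSum_sq (s : Finset ι) :
    ∑ t ∈ s.powerset, signedSum a s t ^ 2 = 2 ^ s.card * ∑ j ∈ s, a j ^ 2 := by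
  induction s using Finset.induction_on with
  | empty => simp [signedSum]
  | insert i s hi ih =>
    rw [Finset.sum_powerset_insert hi, ← Finset.sum_add_distrib, Finset.card_insert_of_notMem hi,
      Finset.sum_insert hi]
    calc _ = ∑ t ∈ s.powerset, (2 * signedSum a s t ^ 2 + 2 * a i ^ 2) := by
            refine Finset.sum_congr rfl fun t ht => ?_
            rw [signedSum_insert_right a hi,
              signedSum_insert_left a hi (Finset.mem_powerset.1 ht)]
            ring
      _ = _ := by
            rw [Finset.sum_add_distrib, ← Finset.mul_sum, ih]
            simp only [Finset.sum_const, Finset.card_powerset, nsmul_eq_mul]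
            push_cast
            ring

/-- Khintchine's inequality for the fourth moment. -/
lemma sum_signedSum_pow_four_le (s : Finset ι) :
    ∑ t ∈ s.powerset, signedSum a s t ^ 4 ≤ 2 ^ s.card * (3 * (∑ j ∈ s, a j ^ 2) ^ 2) := by
  induction s using Finset.induction_on with
  | empty => simp [signedSum]
  | insert i s hi ih =>
    rw [Finset.sum_powerset_insert hi, ← Finset.sum_add_distrib, Finset.card_insert_of_notMem hi,
      Finset.sum_insert hi]
    calc _ = ∑ t ∈ s.powerset,
              (2 * signedSum a s t ^ 4 + 12 * a i ^ 2 * signedSum a s t ^ 2 + 2 * a i ^ 4) := by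
            refine Finset.sum_congr rfl fun t ht => ?_
            rw [signedSum_insert_right a hi,
              signedSum_insert_left a hi (Finset.mem_powerset.1 ht)]
            ring
      _ = 2 * ∑ t ∈ s.powerset, signedSum a s t ^ 4 +
            2 ^ s.card * (12 * a i ^ 2 * ∑ j ∈ s, a j ^ 2 + 2 * a i ^ 4) := by
            rw [Finset.sum_add_distrib, Finset.sum_add_distrib, ← Finset.mul_sum,
              ← Finset.mul_sum, sum_signedSum_sq]
            simp only [Finset.sum_const, Finset.card_powerset, nsmul_eq_mul]
            push_cast
            ring
      _ ≤ 2 * (2 ^ s.card * (3 * (∑ j ∈ s, a j ^ 2) ^ 2)) +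
            2 ^ s.card * (12 * a i ^ 2 * ∑ j ∈ s, a j ^ 2 + 6 * a i ^ 4) := by
            gcongr
            norm_num
      _ = _ := by ring

/-- Anti-concentration of Rademacher sums (Paley–Zygmund): a proportion at least `3 / 10` of the
signed sums exceed, in absolute value, an eighth of their standard deviation. -/
lemma card_signedSum_large {r : ℝ} (s : Finset ι)
    (h : 64 * r ^ 2 < ∑ j ∈ s, a j ^ 2) :
    3 / 10 * 2 ^ s.card ≤ ((s.powerset.filter fun t => r < |signedSum a s t|).card : ℝ) := by
  set V := ∑ j ∈ s, a j ^ 2 with hV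
  have hV0 : 0 < V := lt_of_le_of_lt (by positivity) h
  -- With `x = T ^ 2 / V`, the indicator of `x > 1 / 64` is at least
  -- `(2 / 3) (x - 1 / 64) - x ^ 2 / 9`, which is at most `1` because
  -- `(2 / 3) x - x ^ 2 / 9 = 1 - (x - 3) ^ 2 / 9`.
  have key : ∀ t, 2 / 3 * (signedSum a s t ^ 2 / V - 1 / 64) - signedSum a s t ^ 4 / V ^ 2 / 9 ≤
      if r < |signedSum a s t| then (1 : ℝ) else 0 := by
    intro t
    have hx : signedSum a s t ^ 4 / V ^ 2 = (signedSum a s t ^ 2 / V) ^ 2 := by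
      rw [div_pow]; ring
    rw [hx]
    split_ifs with ht
    · nlinarith [sq_nonneg (signedSum a s t ^ 2 / V - 3)]
    · have h1 : signedSum a s t ^ 2 ≤ r ^ 2 := by
        rw [← sq_abs]
        exact pow_le_pow_left₀ (abs_nonneg _) (not_lt.1 ht) 2
      have h2 : signedSum a s t ^ 2 / V ≤ 1 / 64 := by
        rw [div_le_iff₀ hV0]; linarith
      nlinarith [sq_nonneg (signedSum a s t ^ 2 / V)]
  have hsum := Finset.sum_le_sum fun t (_ : t ∈ s.powerset) => key t
  rw [Finset.sum_boole, Finset.sum_sub_distrib, ← Finset.mul_sum, Finset.sum_sub_distrib,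
    ← Finset.sum_div, ← Finset.sum_div, ← Finset.sum_div, ← Finset.sum_div, sum_signedSum_sq, ← hV] at hsum
  have h4 : (∑ t ∈ s.powerset, signedSum a s t ^ 4) / V ^ 2 ≤ 2 ^ s.card * 3 := by
    rw [div_le_iff₀ (by positivity)]
    linarith [sum_signedSum_pow_four_le a s]
  rw [mul_div_assoc, div_self hV0.ne', Finset.sum_const, Finset.card_powerset, nsmul_eq_mul]
    at hsum
  push_cast at hsum
  have : (0 : ℝ) < 2 ^ s.card := by positivity
  linarith

end Signs

section Rounding

variable {d : ℕ}

lemma inner_toEuclideanCLM_eq_sum (A : Matrix (Fin d) (Fin d) ℝ) (w : EuclideanSpace ℝ (Fin d)) :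
    inner ℝ w (Matrix.toEuclideanCLM (n := Fin d) (𝕜 := ℝ) A w) =
      ∑ i, ∑ j, A i j * (w i * w j) := by
  rw [Matrix.inner_toEuclideanCLM]
  simp only [dotProduct, Matrix.mulVec, Finset.mul_sum]
  exact Finset.sum_congr rfl fun i _ => Finset.sum_congr rfl fun j _ => by ring

/-- With `M = ∑ λ_j u_j u_jᵀ`, one has `‖M^{1/2} z‖² = ∑ λ_j ⟨u_j, z⟩²`. -/
lemma norm_sqrt_sq_eq_sum_eigenvalues {M : Matrix (Fin d) (Fin d) ℝ} (hM : M.PosSemidef)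
    (z : EuclideanSpace ℝ (Fin d)) :
    ‖Matrix.toEuclideanCLM (n := Fin d) (𝕜 := ℝ) (CFC.sqrt M) z‖ ^ 2 =
      ∑ j, hM.isHermitian.eigenvalues j * inner ℝ (hM.isHermitian.eigenvectorBasis j) z ^ 2 := by
  set T := Matrix.toEuclideanCLM (n := Fin d) (𝕜 := ℝ)
  have hadj : ∀ A : Matrix (Fin d) (Fin d) ℝ, IsSelfAdjoint A →
      ∀ x y, inner ℝ (T A x) y = inner ℝ x (T A y) := by
    intro A hA x y
    rw [← ContinuousLinearMap.adjoint_inner_left, ← ContinuousLinearMap.star_eq_adjoint,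
      (hA.map T).star_eq]
  have h1 : ‖T (CFC.sqrt M) z‖ ^ 2 = inner ℝ (T M z) z := by
    rw [← real_inner_self_eq_norm_sq, ← hadj _ (CFC.sqrt_nonneg M).isSelfAdjoint,
      ← CFC.sqrt_mul_sqrt_self M hM.nonneg, map_mul, CFC.sqrt_mul_sqrt_self M hM.nonneg]
    rfl
  have h2 : ∀ j, T M (hM.isHermitian.eigenvectorBasis j) =
      hM.isHermitian.eigenvalues j • hM.isHermitian.eigenvectorBasis j := by
    intro j
    ext i
    exact congrFun (hM.isHermitian.mulVec_eigenvectorBasis j) i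
  rw [h1, ← hM.isHermitian.eigenvectorBasis.sum_inner_mul_inner]
  refine Finset.sum_congr rfl fun j _ => ?_
  rw [hadj _ hM.isHermitian, h2, inner_smul_right, real_inner_comm]
  ring

/-- If in every direction `v` only few of the points `z_k` satisfy `|⟨z_k, v⟩| > r`, then for every
density matrix `M` only few of them satisfy `‖M^{1/2} z_k‖ > 8 r`. The directions used are
`∑ ± √λ_j u_j` with `λ_j`, `u_j` the spectral data of `M`; they have norm one because
`Tr M = 1`. -/
lemma card_norm_sqrt_large_le {κ : Type*} [Fintype κ] {M : Matrix (Fin d) (Fin d) ℝ}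
    (hM : M.PosSemidef) (htr : M.trace = 1) (z : κ → EuclideanSpace ℝ (Fin d)) {r c : ℝ}
    (hr : 0 ≤ r)
    (h : ∀ v : EuclideanSpace ℝ (Fin d), ‖v‖ = 1 →
      ((Finset.univ.filter fun k => r < |inner ℝ (z k) v|).card : ℝ) ≤ c) :
    3 / 10 * ((Finset.univ.filter fun k =>
      8 * r < ‖Matrix.toEuclideanCLM (n := Fin d) (𝕜 := ℝ) (CFC.sqrt M) (z k)‖).card : ℝ) ≤ c := by
  classical
  set u := hM.isHermitian.eigenvectorBasis
  set l := hM.isHermitian.eigenvalues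
  have hl : ∀ j, 0 ≤ l j := hM.eigenvalues_nonneg
  let v : Finset (Fin d) → EuclideanSpace ℝ (Fin d) := fun t =>
    ∑ j, (if j ∈ t then √(l j) else -√(l j)) • u j
  have hv : ∀ t, ‖v t‖ = 1 := by
    intro t
    have h1 : ‖v t‖ ^ 2 = 1 := by
      rw [← real_inner_self_eq_norm_sq, u.orthonormal.inner_sum]
      rw [← htr, hM.isHermitian.trace_eq_sum_eigenvalues]
      refine Finset.sum_congr rfl fun j _ => ?_
      split_ifs <;> simp [Real.mul_self_sqrt (hl j), l]
    nlinarith [norm_nonneg (v t)]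
  have hz : ∀ k t, inner ℝ (z k) (v t) =
      signedSum (fun j => √(l j) * inner ℝ (u j) (z k)) Finset.univ t := by
    intro k t
    simp only [v, inner_sum, signedSum, inner_smul_right, real_inner_comm (u _) (z k)]
    refine Finset.sum_congr rfl fun j _ => ?_
    split_ifs <;> simp [real_inner_comm]
  set D := Finset.univ.filter fun k =>
    8 * r < ‖Matrix.toEuclideanCLM (n := Fin d) (𝕜 := ℝ) (CFC.sqrt M) (z k)‖
  have hD : ∀ k ∈ D, 3 / 10 * 2 ^ d ≤
      ((Finset.univ.filter fun t => r < |inner ℝ (z k) (v t)|).card : ℝ) := by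
    intro k hk
    have hk' : 8 * r < _ := (Finset.mem_filter.1 hk).2
    have := card_signedSum_large (fun j => √(l j) * inner ℝ (u j) (z k)) (r := r) Finset.univ (by
      have h2 := pow_lt_pow_left₀ hk' (by positivity) two_ne_zero
      rw [norm_sqrt_sq_eq_sum_eigenvalues hM] at h2
      simp only [mul_pow, Real.sq_sqrt (hl _)]
      linarith)
    simpa [hz] using this
  have h3 : ∑ k ∈ D, (3 / 10 * 2 ^ d : ℝ) ≤ ∑ t : Finset (Fin d), c := by
    calc _ ≤ ∑ k ∈ D, ∑ t : Finset (Fin d), if r < |inner ℝ (z k) (v t)| then (1 : ℝ) else 0 := by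
          refine Finset.sum_le_sum fun k hk => ?_
          rw [Finset.sum_boole]
          exact hD k hk
      _ = ∑ t : Finset (Fin d), ∑ k ∈ D, if r < |inner ℝ (z k) (v t)| then (1 : ℝ) else 0 :=
          Finset.sum_comm
      _ ≤ _ := by
          refine Finset.sum_le_sum fun t _ => le_trans ?_ (h (v t) (hv t))
          rw [Finset.sum_boole]
          exact_mod_cast Finset.card_le_card (Finset.filter_subset_filter _ (Finset.subset_univ _))
  simp only [Finset.sum_const, nsmul_eq_mul, Finset.card_univ, Fintype.card_finset,
    Fintype.card_fin] at h3
  push_cast at h3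
  have : (0 : ℝ) < 2 ^ d := by positivity
  refine le_of_mul_le_mul_left ?_ this
  linarith

end Rounding

/-! ### Gaussian perturbations and the PAC-Bayes inequality -/

section Gaussian

variable {E : Type*} [NormedAddCommGroup E] [InnerProductSpace ℝ E]

/-- The density of the standard Gaussian measure with respect to Lebesgue measure. -/
noncomputable def stdGaussianPDF (x : E) : ℝ :=
  ((2 * Real.pi) ^ (Module.finrank ℝ E / 2 : ℝ))⁻¹ * Real.exp (-‖x‖ ^ 2 / 2)

lemma stdGaussianPDF_nonneg (x : E) : 0 ≤ stdGaussianPDF x := by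
  unfold stdGaussianPDF; positivity

variable [MeasurableSpace E] [BorelSpace E]

lemma measurable_stdGaussianPDF : Measurable (stdGaussianPDF : E → ℝ) := by
  unfold stdGaussianPDF; fun_prop

variable [FiniteDimensional ℝ E]

lemma integrable_stdGaussianPDF : Integrable (stdGaussianPDF : E → ℝ) := by
  have h := (GaussianFourier.integrable_cexp_neg_mul_sq_norm_add (V := E)
    (b := 1 / 2) (by norm_num) 0 0).norm
  refine Integrable.const_mul (h.congr (ae_of_all _ fun x => ?_)) _
  simp only [Complex.norm_exp]
  congr 1
  simp [← Complex.ofReal_pow]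
  ring

/-- Both sides have the characteristic function `exp (-‖t‖² / 2)`. -/
lemma stdGaussian_eq_withDensity :
    stdGaussian E = volume.withDensity fun x => ENNReal.ofReal (stdGaussianPDF x) := by
  have : IsFiniteMeasure (volume.withDensity fun x : E => ENNReal.ofReal (stdGaussianPDF x)) :=
    isFiniteMeasure_withDensity_ofReal integrable_stdGaussianPDF.2
  refine Measure.ext_of_charFun (funext fun t => ?_)
  rw [charFun_stdGaussian, charFun_apply]
  symm
  rw [integral_withDensity_eq_integral_toReal_smul
    (by have := measurable_stdGaussianPDF (E := E); fun_prop) (by simp)]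
  have h := GaussianFourier.integral_cexp_neg_mul_sq_norm_add (V := E)
    (b := 1 / 2) (by norm_num) Complex.I t
  have hc : ((2 * Real.pi : ℝ) : ℂ) ^ (Module.finrank ℝ E / 2 : ℂ) =
      (((2 * Real.pi) ^ (Module.finrank ℝ E / 2 : ℝ) : ℝ) : ℂ) := by
    rw [Complex.ofReal_cpow (by positivity)]
    push_cast
    rfl
  have hpi : ((Real.pi : ℂ) / (1 / 2)) = ((2 * Real.pi : ℝ) : ℂ) := by push_cast; ring
  rw [hpi, hc] at h
  have h0 : (((2 * Real.pi) ^ (Module.finrank ℝ E / 2 : ℝ) : ℝ) : ℂ) ≠ 0 := by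
    exact_mod_cast (show (2 * Real.pi) ^ (Module.finrank ℝ E / 2 : ℝ) ≠ 0 by positivity)
  calc ∫ x : E, (ENNReal.ofReal (stdGaussianPDF x)).toReal •
          Complex.exp ((inner ℝ x t : ℝ) * Complex.I)
      = ∫ x : E, (((2 * Real.pi) ^ (Module.finrank ℝ E / 2 : ℝ) : ℝ) : ℂ)⁻¹ *
          Complex.exp (-(1 / 2) * (‖x‖ : ℂ) ^ 2 + Complex.I * (inner ℝ t x : ℝ)) := by
        refine integral_congr_ae (ae_of_all _ fun x => ?_)
        simp only [ENNReal.toReal_ofReal (stdGaussianPDF_nonneg x)]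
        simp only [stdGaussianPDF, Complex.real_smul]
        rw [Complex.exp_add, real_inner_comm]
        push_cast
        ring_nf
    _ = _ := by
        rw [integral_const_mul, h, inv_mul_cancel_left₀ h0, Complex.I_sq]
        congr 1
        ring

/-- The Cameron–Martin formula for the standard Gaussian measure. -/
lemma lintegral_stdGaussian_shift {F : E → ENNReal} (hF : Measurable F) (u : E) :
    ∫⁻ x, F x ∂(stdGaussian E) =
      ∫⁻ g, F (g + u) * ENNReal.ofReal (Real.exp (-inner ℝ u g - ‖u‖ ^ 2 / 2))
        ∂(stdGaussian E) := by
  have hm : Measurable fun x : E => ENNReal.ofReal (stdGaussianPDF x) :=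
    measurable_stdGaussianPDF.ennreal_ofReal
  rw [stdGaussian_eq_withDensity, lintegral_withDensity_eq_lintegral_mul _ hm hF,
    lintegral_withDensity_eq_lintegral_mul _ hm (by fun_prop), ← lintegral_add_right_eq_self _ u]
  refine lintegral_congr fun g => ?_
  simp only [Pi.mul_apply]
  rw [mul_left_comm, ← ENNReal.ofReal_mul (stdGaussianPDF_nonneg g), mul_comm]
  congr 2
  rw [stdGaussianPDF, stdGaussianPDF, mul_assoc, ← Real.exp_add, norm_add_sq_real,
    real_inner_comm]
  ring_nf

lemma integrable_inner_stdGaussian (u : E) :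
    Integrable (fun g => inner ℝ u g) (stdGaussian E) :=
  (innerSL ℝ u).integrable_comp IsGaussian.integrable_id

lemma integral_inner_stdGaussian (u : E) : ∫ g, inner ℝ u g ∂(stdGaussian E) = 0 :=
  integral_strongDual_stdGaussian (innerSL ℝ u)

/-- The PAC-Bayes inequality with standard Gaussian prior and its translates as posteriors: an
exponential moment of `h` under the prior bounds the mean of `h` under the translate by `u`, up to
the Kullback–Leibler divergence `‖u‖² / 2`. The proof is the Cameron–Martin formula followed by
Jensen's inequality. -/
lemma integral_shift_le_of_lintegral_exp_le {h : E → ℝ} (hm : Measurable h) {L : ℝ}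
    (hL : ∫⁻ g, ENNReal.ofReal (Real.exp (h g)) ∂(stdGaussian E) ≤ ENNReal.ofReal (Real.exp L))
    (u : E) (hi : Integrable (fun g => h (g + u)) (stdGaussian E)) :
    ∫ g, h (g + u) ∂(stdGaussian E) ≤ ‖u‖ ^ 2 / 2 + L := by
  rw [lintegral_stdGaussian_shift (by fun_prop) u] at hL
  simp only [← ENNReal.ofReal_mul (Real.exp_nonneg _), ← Real.exp_add] at hL
  set ξ : E → ℝ := fun g => h (g + u) + (-inner ℝ u g - ‖u‖ ^ 2 / 2) with hξ
  have hξm : Measurable ξ := by fun_prop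
  have hs : Integrable (fun g => -inner ℝ u g - ‖u‖ ^ 2 / 2) (stdGaussian E) :=
    (integrable_inner_stdGaussian u).neg.sub (integrable_const _)
  have hξi : Integrable ξ (stdGaussian E) := hi.add hs
  have hξint : ∫ g, ξ g ∂(stdGaussian E) = ∫ g, h (g + u) ∂(stdGaussian E) - ‖u‖ ^ 2 / 2 := by
    simp only [hξ]
    rw [integral_add hi hs, integral_sub (integrable_inner_stdGaussian u).fun_neg
      (integrable_const _), integral_neg, integral_inner_stdGaussian]
    simp
    ring
  have hei : Integrable (fun g => Real.exp (ξ g)) (stdGaussian E) := by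
    refine ⟨by fun_prop, ?_⟩
    rw [hasFiniteIntegral_iff_ofReal (ae_of_all _ fun _ => Real.exp_nonneg _)]
    exact hL.trans_lt ENNReal.ofReal_lt_top
  have hJ : Real.exp (∫ g, ξ g ∂(stdGaussian E)) ≤ ∫ g, Real.exp (ξ g) ∂(stdGaussian E) :=
    convexOn_exp.map_integral_le Real.continuous_exp.continuousOn isClosed_univ (by simp) hξi hei
  have hU : ∫ g, Real.exp (ξ g) ∂(stdGaussian E) ≤ Real.exp L := by
    rw [integral_eq_lintegral_of_nonneg_ae (ae_of_all _ fun _ => Real.exp_nonneg _)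
      (by fun_prop)]
    exact ENNReal.toReal_le_of_le_ofReal (Real.exp_nonneg _) hL
  have := Real.exp_le_exp.1 (hJ.trans hU)
  linarith

instance isNegInvariant_stdGaussian : (stdGaussian E).IsNegInvariant := by
  refine ⟨?_⟩
  have := stdGaussian_map (LinearIsometryEquiv.neg ℝ (E := E))
  exact this

lemma integrable_indicator_inner (z u : E) (R : ℝ) :
    Integrable (fun g => if R < |inner ℝ z (g + u)| then (1 : ℝ) else 0) (stdGaussian E) := by
  refine Integrable.of_bound (C := 1) ?_ (ae_of_all _ fun g => ?_)
  · exact (Measurable.ite (measurableSet_lt (by fun_prop) (by fun_prop)) (by fun_prop)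
      (by fun_prop)).aestronglyMeasurable
  · split_ifs <;> simp

/-- By symmetry, a Gaussian perturbation of `u` is at least as far from the hyperplane `zᗮ` as
`u` with probability at least one half. -/
lemma half_le_integral_indicator {z u : E} {R : ℝ} (h : R < |inner ℝ z u|) :
    1 / 2 ≤ ∫ g, (if R < |inner ℝ z (g + u)| then (1 : ℝ) else 0) ∂(stdGaussian E) := by
  have hm := integrable_indicator_inner z u R
  have h2 : ∫ g, (if R < |inner ℝ z (g + u)| then (1 : ℝ) else 0) ∂(stdGaussian E) =
      ∫ g, (if R < |inner ℝ z (-g + u)| then (1 : ℝ) else 0) ∂(stdGaussian E) :=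
    (integral_neg_eq_self (fun g => if R < |inner ℝ z (g + u)| then (1 : ℝ) else 0) _).symm
  have hm2 : Integrable (fun g => if R < |inner ℝ z (-g + u)| then (1 : ℝ) else 0)
      (stdGaussian E) := hm.comp_neg
  have h3 : ∫ _, (1 : ℝ) ∂(stdGaussian E) ≤
      ∫ g, ((if R < |inner ℝ z (g + u)| then (1 : ℝ) else 0) +
        (if R < |inner ℝ z (-g + u)| then (1 : ℝ) else 0)) ∂(stdGaussian E) := by
    refine integral_mono (integrable_const _) (hm.add hm2) fun g => ?_
    simp only [inner_add_right, inner_neg_right]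
    -- At least one of `⟨z, u⟩ ± ⟨z, g⟩` is at least as large as `⟨z, u⟩` in absolute value.
    have : R < |inner ℝ z g + inner ℝ z u| ∨ R < |-inner ℝ z g + inner ℝ z u| := by
      by_contra! hc
      have := abs_add_le (inner ℝ z g + inner ℝ z u) (-inner ℝ z g + inner ℝ z u)
      rw [show inner ℝ z g + inner ℝ z u + (-inner ℝ z g + inner ℝ z u) = 2 * inner ℝ z u by ring,
        abs_mul, abs_two] at this
      linarith [hc.1, hc.2]
    rcases this with h | h <;> simp only [h, if_true] <;> split_ifs <;> norm_num
  rw [integral_add hm hm2, ← h2] at h3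
  simp at h3
  linarith

end Gaussian

section Moments

variable {d : ℕ}

lemma memLp_coord_shift (u : EuclideanSpace ℝ (Fin d)) (i : Fin d) :
    MemLp (fun g : EuclideanSpace ℝ (Fin d) => (g + u) i) 2 (stdGaussian _) := by
  have h : MemLp id 2 (stdGaussian (EuclideanSpace ℝ (Fin d))) := IsGaussian.memLp_two_id
  exact (h.add (memLp_const u)).eval_piLp i

lemma integral_coord_shift_mul (u : EuclideanSpace ℝ (Fin d)) (i j : Fin d) :
    ∫ g, (g + u) i * (g + u) j ∂(stdGaussian (EuclideanSpace ℝ (Fin d))) =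
      (if i = j then 1 else 0) + u i * u j := by
  set γ := stdGaussian (EuclideanSpace ℝ (Fin d))
  have hL : ∀ i, MemLp (fun g : EuclideanSpace ℝ (Fin d) => g i) 2 γ := fun i => by
    simpa using memLp_coord_shift 0 i
  have h0 : ∀ i, ∫ g, g i ∂γ = 0 := fun i =>
    integral_strongDual_stdGaussian (EuclideanSpace.proj (𝕜 := ℝ) i)
  have h1 : ∫ g, g i * g j ∂γ = if i = j then 1 else 0 := by
    have h := covarianceBilin_apply_eq_cov (μ := γ) IsGaussian.memLp_two_id
      (EuclideanSpace.single i (1 : ℝ)) (EuclideanSpace.single j (1 : ℝ))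
    simp only [EuclideanSpace.inner_single_left, map_one, one_mul] at h
    rw [covariance_eq_sub (hL i) (hL j), h0, h0, covarianceBilin_stdGaussian] at h
    simp only [mul_zero, sub_zero, Pi.mul_apply] at h
    rw [← h, innerSL_apply_apply ℝ]
    rw [EuclideanSpace.inner_single_left]
    simp
  have hi : Integrable (fun g : EuclideanSpace ℝ (Fin d) => g i * g j) γ :=
    (hL i).integrable_mul (hL j)
  have hg : ∀ i, Integrable (fun g : EuclideanSpace ℝ (Fin d) => g i) γ := fun i =>
    (hL i).integrable (by norm_num)
  calc _ = ∫ g, (g i * g j + u j * g i + u i * g j + u i * u j) ∂γ := by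
        refine integral_congr_ae (ae_of_all _ fun g => ?_)
        simp only [PiLp.add_apply]
        ring
    _ = _ := by
        rw [integral_add ((hi.fun_add ((hg i).const_mul _)).fun_add ((hg j).const_mul _))
            (integrable_const _),
          integral_add (hi.fun_add ((hg i).const_mul _)) ((hg j).const_mul _),
          integral_add hi ((hg i).const_mul _), integral_const_mul, integral_const_mul, h0, h0, h1]
        simp

lemma integrable_quadratic_shift (A : Matrix (Fin d) (Fin d) ℝ) (u : EuclideanSpace ℝ (Fin d)) :
    Integrable (fun g => inner ℝ (g + u)
      (Matrix.toEuclideanCLM (n := Fin d) (𝕜 := ℝ) A (g + u))) (stdGaussian _) := by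
  simp only [inner_toEuclideanCLM_eq_sum]
  exact integrable_finsetSum _ fun i _ => integrable_finsetSum _ fun j _ =>
    ((memLp_coord_shift u i).integrable_mul (memLp_coord_shift u j)).const_mul _

/-- The mean of a quadratic form under a translated Gaussian. -/
lemma integral_quadratic_shift (A : Matrix (Fin d) (Fin d) ℝ) (u : EuclideanSpace ℝ (Fin d)) :
    ∫ g, inner ℝ (g + u) (Matrix.toEuclideanCLM (n := Fin d) (𝕜 := ℝ) A (g + u))
      ∂(stdGaussian _) =
    A.trace + inner ℝ u (Matrix.toEuclideanCLM (n := Fin d) (𝕜 := ℝ) A u) := by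
  have hi : ∀ i j, Integrable (fun g : EuclideanSpace ℝ (Fin d) =>
      A i j * ((g + u) i * (g + u) j)) (stdGaussian _) := fun i j =>
    ((memLp_coord_shift u i).integrable_mul (memLp_coord_shift u j)).const_mul _
  simp only [inner_toEuclideanCLM_eq_sum]
  rw [integral_finsetSum _ fun i _ => integrable_finsetSum _ fun j _ => hi i j]
  simp only [integral_finsetSum _ fun j _ => hi _ j, integral_const_mul, integral_coord_shift_mul,
    mul_add, Finset.sum_add_distrib]
  simp [Matrix.trace]

end Moments

/-! ### Exponential moments of the number of exceedances -/

section Independence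

/-- Functions of pairwise disjoint sets of independent variables are independent; stated as the
product formula for expectations of nonnegative functions. -/
lemma lintegral_prod_of_dependsOn {Ω ι κ β : Type*} [MeasurableSpace Ω] {P : Measure Ω}
    [MeasurableSpace β] [Nonempty β] {X : ι → Ω → β} (hX : iIndepFun X P)
    (hm : ∀ i, Measurable (X i)) {S : κ → Finset ι}
    (hS : Pairwise fun k l => Disjoint (S k) (S l)) {g : κ → (ι → β) → ENNReal}
    (hg : ∀ k, Measurable (g k)) (hdep : ∀ k, DependsOn (g k) (S k)) (T : Finset κ) :
    ∫⁻ ω, ∏ k ∈ T, g k (fun i => X i ω) ∂P = ∏ k ∈ T, ∫⁻ ω, g k (fun i => X i ω) ∂P := by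
  classical
  have := hX.isProbabilityMeasure
  -- Extension by an arbitrary value turns a function of all the variables into a function of
  -- those in `U`.
  let e : ∀ U : Finset ι, (U → β) → ι → β := fun U y i =>
    if h : i ∈ U then y ⟨i, h⟩ else Classical.arbitrary β
  have he : ∀ U, Measurable (e U) := fun U => measurable_pi_lambda _ fun i => by
    by_cases h : i ∈ U
    · simpa [e, h] using measurable_pi_apply _
    · simp [e, h]
  have hXm : Measurable fun ω i => X i ω := measurable_pi_lambda _ hm
  have hgm : ∀ k, Measurable fun ω => g k fun i => X i ω := fun k => (hg k).comp hXm
  induction T using Finset.induction_on with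
  | empty => simp
  | insert j T hj ih =>
    have hd : Disjoint (S j) (T.biUnion S) := by
      rw [Finset.disjoint_biUnion_right]
      exact fun k hk => hS fun h => hj (h ▸ hk)
    have hind := (hX.indepFun_finset _ _ hd hm).comp ((hg j).comp (he _))
      ((T.measurable_fun_prod fun k _ => hg k).comp (he _))
    have h1 : (g j ∘ e (S j)) ∘ (fun ω (i : S j) => X i ω) = fun ω => g j fun i => X i ω := by
      funext ω
      exact hdep j fun i hi => by simp [e, Finset.mem_coe.1 hi]
    have h2 : ((fun x => ∏ k ∈ T, g k x) ∘ e (T.biUnion S)) ∘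
        (fun ω (i : T.biUnion S) => X i ω) = fun ω => ∏ k ∈ T, g k fun i => X i ω := by
      funext ω
      refine Finset.prod_congr rfl fun k hk => hdep k fun i hi => ?_
      have : i ∈ T.biUnion S := Finset.mem_biUnion.2 ⟨k, hk, hi⟩
      simp only [e, dif_pos this]
    rw [h1, h2] at hind
    simp only [Finset.prod_insert hj]
    rw [lintegral_mul_eq_lintegral_mul_lintegral_of_indepFun''
      (hgm j).aemeasurable (T.measurable_fun_prod fun k _ => hgm k).aemeasurable hind, ih]

end Independence

section Blocks

variable {N K d : ℕ}

instance BlockSplit.instFinite : Finite (BlockSplit N K) :=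
  Finite.of_injective BlockSplit.block fun b c h => by cases b; cases c; cases h; rfl

/-- The contribution of the informative data to the centred mean over the `k`-th block. It is
normalised by the full block size, so it equals the centred block mean when the block contains no
outlier, and it is well behaved even when it does. -/
noncomputable def cleanMean {O : Finset (Fin N)} (μ : EuclideanSpace ℝ (Fin d))
    (b : BlockSplit N K) (x : {i // i ∉ O} → EuclideanSpace ℝ (Fin d)) (k : Fin K) :
    EuclideanSpace ℝ (Fin d) :=
  ((N / K : ℕ) : ℝ)⁻¹ • ∑ i ∈ (b.block k).subtype (· ∉ O), (x i - μ)

lemma blockMean_sub_eq_cleanMean {O : Finset (Fin N)} (μ : EuclideanSpace ℝ (Fin d))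
    (b : BlockSplit N K) (x : Fin N → EuclideanSpace ℝ (Fin d)) {k : Fin K} (hm : 0 < N / K)
    (hk : Disjoint (b.block k) O) :
    blockMean b x k - μ = cleanMean μ b (fun i : {i // i ∉ O} => x i) k := by
  have hf : (b.block k).filter (· ∉ O) = b.block k :=
    Finset.filter_true_of_mem fun i hi => Finset.disjoint_left.1 hk hi
  rw [blockMean, cleanMean, b.card_block k,
    Finset.sum_subtype_eq_sum_filter (p := (· ∉ O)) (f := fun i => x i - μ), hf,
    Finset.sum_sub_distrib, Finset.sum_const, b.card_block k, smul_sub, ← Nat.cast_smul_eq_nsmul ℝ,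
    inv_smul_smul₀ (by positivity)]

lemma measurable_cleanMean {O : Finset (Fin N)} (μ : EuclideanSpace ℝ (Fin d))
    (b : BlockSplit N K) (k : Fin K) :
    Measurable fun x : {i // i ∉ O} → EuclideanSpace ℝ (Fin d) => cleanMean μ b x k := by
  unfold cleanMean
  fun_prop

/-- Each outlier spoils at most one block. -/
lemma card_not_disjoint_le (b : BlockSplit N K) (O : Finset (Fin N)) :
    (Finset.univ.filter fun k => ¬ Disjoint (b.block k) O).card ≤ O.card := by
  refine Finset.card_le_card_of_forall_subsingleton (fun k i => i ∈ b.block k) (fun k hk => ?_)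
    fun i _ k hk l hl => ?_
  · obtain ⟨i, hi, hO⟩ := Finset.not_disjoint_iff.1 (Finset.mem_filter.1 hk).2
    exact ⟨i, hO, hi⟩
  · by_contra hne
    exact Finset.disjoint_left.1 (b.disjoint hne) hk.2 hl.2

variable {Ω : Type*} [MeasurableSpace Ω] {P : Measure Ω}

lemma Matrix.PosSemidef.inner_toEuclideanCLM_nonneg {A : Matrix (Fin d) (Fin d) ℝ}
    (hA : A.PosSemidef) (w : EuclideanSpace ℝ (Fin d)) :
    0 ≤ inner ℝ w (Matrix.toEuclideanCLM (n := Fin d) (𝕜 := ℝ) A w) := by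
  rw [Matrix.inner_toEuclideanCLM]
  simpa using hA.dotProduct_mulVec_nonneg (w : Fin d → ℝ)

lemma integral_inner_sub_sq_le {Y : Ω → EuclideanSpace ℝ (Fin d)}
    {μ : EuclideanSpace ℝ (Fin d)} {S : Matrix (Fin d) (Fin d) ℝ} [IsFiniteMeasure P]
    (hY : MemLp Y 2 P) (hS : secondMomentAbout P Y μ ≤ S) (w : EuclideanSpace ℝ (Fin d)) :
    ∫ ω, inner ℝ (Y ω - μ) w ^ 2 ∂P ≤
      inner ℝ w (Matrix.toEuclideanCLM (n := Fin d) (𝕜 := ℝ) S w) := by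
  have hc : ∀ a, MemLp (fun ω => Y ω a - μ a) 2 P := fun a =>
    (hY.eval_piLp a).sub (memLp_const _)
  have hi : ∀ a b, Integrable (fun ω => (Y ω a - μ a) * (Y ω b - μ b)) P := fun a b =>
    (hc a).integrable_mul (hc b)
  have h1 : ∫ ω, inner ℝ (Y ω - μ) w ^ 2 ∂P =
      inner ℝ w (Matrix.toEuclideanCLM (n := Fin d) (𝕜 := ℝ) (secondMomentAbout P Y μ) w) := by
    rw [inner_toEuclideanCLM_eq_sum]
    simp only [secondMomentAbout, Matrix.of_apply, ← integral_mul_const]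
    simp only [← integral_finsetSum _ fun b _ => (hi _ b).mul_const _]
    rw [← integral_finsetSum _ fun a _ => integrable_finsetSum _ fun b _ => (hi a b).mul_const _]
    refine integral_congr_ae (ae_of_all _ fun ω => ?_)
    simp only [PiLp.inner_apply, PiLp.sub_apply, RCLike.inner_apply, conj_trivial, sq,
      Finset.sum_mul_sum]
    exact Finset.sum_congr rfl fun a _ => Finset.sum_congr rfl fun b _ => by ring
  have h2 := (Matrix.le_iff.1 hS).inner_toEuclideanCLM_nonneg w
  rw [map_sub, sub_apply,
    inner_sub_right] at h2
  linarith

variable [IsProbabilityMeasure P] {X : Fin N → Ω → EuclideanSpace ℝ (Fin d)}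
  {O : Finset (Fin N)} {μ : EuclideanSpace ℝ (Fin d)} {S : Matrix (Fin d) (Fin d) ℝ}

/-- Chebyshev's inequality for one block in one direction. For `R = 0` the right-hand side is zero
by convention, which is why the covariance then has to vanish. -/
lemma ContaminatedSample.measure_cleanMean_large_le (hX : ContaminatedSample P X O μ S)
    (b : BlockSplit N K) (k : Fin K) {R : ℝ} (hR : 0 ≤ R)
    (hR0 : R = 0 → S = 0) (hS : S.PosSemidef) (w : EuclideanSpace ℝ (Fin d)) :
    P {ω | R < |inner ℝ (cleanMean μ b (fun i : {i // i ∉ O} => X i ω) k) w|} ≤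
      ENNReal.ofReal (inner ℝ w (Matrix.toEuclideanCLM (n := Fin d) (𝕜 := ℝ) S w) /
        ((N / K : ℕ) * R ^ 2)) := by
  set V := inner ℝ w (Matrix.toEuclideanCLM (n := Fin d) (𝕜 := ℝ) S w) with hV
  set m : ℝ := ((N / K : ℕ) : ℝ) with hm
  set s := (b.block k).subtype (· ∉ O)
  let Y : {i // i ∉ O} → Ω → ℝ := fun i ω => inner ℝ (X i ω - μ) w
  have hXi : ∀ i : {i // i ∉ O}, Integrable (X i) P := fun i =>
    (hX.memLp i i.2).integrable (by norm_num)
  have hYL : ∀ i, MemLp (Y i) 2 P := fun i =>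
    ((hX.memLp i i.2).sub (memLp_const μ)).inner_const w
  have hY0 : ∀ i, ∫ ω, Y i ω ∂P = 0 := fun i => by
    have h := integral_inner (𝕜 := ℝ) ((hXi i).sub (integrable_const μ)) w
    simp only [Pi.sub_apply, integral_sub (hXi i) (integrable_const μ), hX.mean i i.2] at h
    simpa [Y, real_inner_comm] using h
  have hYV : ∀ i, Var[Y i; P] ≤ V := fun i => by
    rw [variance_of_integral_eq_zero (hYL i).aestronglyMeasurable.aemeasurable (hY0 i)]
    exact integral_inner_sub_sq_le (hX.memLp i i.2) (hX.cov_le i i.2) w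
  have hV0 : 0 ≤ V := hS.inner_toEuclideanCLM_nonneg w
  let Z : Ω → ℝ := fun ω => inner ℝ (cleanMean μ b (fun i : {i // i ∉ O} => X i ω) k) w
  have hZ : Z = fun ω => m⁻¹ * (∑ i ∈ s, Y i) ω := by
    funext ω
    simp only [Z, Y, cleanMean, real_inner_smul_left, sum_inner, Finset.sum_apply, hm, s]
  have hZL : MemLp Z 2 P := by
    rw [hZ]
    exact (memLp_finsetSum' s fun i _ => hYL i).const_mul _
  have hZ0 : ∫ ω, Z ω ∂P = 0 := by
    rw [hZ, integral_const_mul]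
    simp only [Finset.sum_apply]
    rw [integral_finsetSum _ fun i _ => (hYL i).integrable (by norm_num)]
    simp [hY0]
  have hcard : (s.card : ℝ) ≤ m := by
    rw [hm, ← b.card_block k, Finset.card_subtype]
    exact_mod_cast Finset.card_filter_le _ _
  have hZV : Var[Z; P] ≤ V / m := by
    rw [hZ, variance_const_mul, IndepFun.variance_sum (fun i _ => hYL i) fun i _ j _ hij => by
      exact (hX.indep.indepFun hij).comp (φ := fun x => inner ℝ (x - μ) w)
        (ψ := fun x => inner ℝ (x - μ) w) (by fun_prop) (by fun_prop)]
    have h1 : ∑ i ∈ s, Var[Y i; P] ≤ m * V := by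
      refine (Finset.sum_le_card_nsmul _ _ _ fun i _ => hYV i).trans ?_
      rw [nsmul_eq_mul]
      gcongr
    rcases eq_or_ne m 0 with h0 | h0
    · simp [h0]
    · calc _ ≤ (m⁻¹) ^ 2 * (m * V) := by gcongr
        _ = V / m := by field_simp
  rcases hR.eq_or_lt with h0 | hpos
  · have hS0 := hR0 h0.symm
    have hV00 : V = 0 := by simp [hV, hS0]
    have hvar : Var[Z; P] = 0 := le_antisymm (by simpa [hV00] using hZV) (variance_nonneg _ _)
    have hae := ae_eq_integral_of_variance_eq_zero hZL hvar
    rw [hV00, ← h0]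
    simp only [zero_div, ENNReal.ofReal_zero, nonpos_iff_eq_zero]
    refine measure_mono_null ?_ hae
    intro ω hω (h : Z ω = ∫ ω, Z ω ∂P)
    have hpos : 0 < |Z ω| := hω
    rw [h, hZ0, abs_zero] at hpos
    exact lt_irrefl _ hpos
  · calc _ ≤ P {ω | R ≤ |Z ω - ∫ ω, Z ω ∂P|} := by
          refine measure_mono fun ω hω => ?_
          simpa [hZ0, Z] using le_of_lt hω
      _ ≤ ENNReal.ofReal (Var[Z; P] / R ^ 2) := meas_ge_le_variance_div_sq hZL hpos
      _ ≤ _ := by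
          rw [← div_div]
          gcongr

/-- The number of blocks whose (clean) mean exceeds `R` in absolute value in the direction `w`. -/
noncomputable def exceedances {O : Finset (Fin N)} (μ : EuclideanSpace ℝ (Fin d)) (R : ℝ)
    (b : BlockSplit N K) (x : {i // i ∉ O} → EuclideanSpace ℝ (Fin d))
    (w : EuclideanSpace ℝ (Fin d)) : ℝ :=
  ∑ k, if R < |inner ℝ (cleanMean μ b x k) w| then 1 else 0

lemma measurable_exceedances {O : Finset (Fin N)} (μ : EuclideanSpace ℝ (Fin d)) (R : ℝ)
    (b : BlockSplit N K) :
    Measurable fun p : ({i // i ∉ O} → EuclideanSpace ℝ (Fin d)) × EuclideanSpace ℝ (Fin d) =>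
      exceedances μ R b p.1 p.2 := by
  refine Finset.measurable_sum _ fun k _ => ?_
  have := measurable_cleanMean (O := O) μ b k
  exact Measurable.ite (measurableSet_lt (by fun_prop) (by fun_prop)) (by fun_prop) (by fun_prop)

/-- The number of exceedances minus `K (e - 1) q`, where `q = ⟨w, S w⟩ / (⌊N / K⌋ R²)` is
Chebyshev's bound on the probability of one exceedance in the direction `w`. -/
noncomputable def compensatedExceedances {O : Finset (Fin N)} (μ : EuclideanSpace ℝ (Fin d))
    (S : Matrix (Fin d) (Fin d) ℝ) (R : ℝ) (b : BlockSplit N K)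
    (x : {i // i ∉ O} → EuclideanSpace ℝ (Fin d)) (w : EuclideanSpace ℝ (Fin d)) : ℝ :=
  exceedances μ R b x w -
    K * ((Real.exp 1 - 1) * (inner ℝ w (Matrix.toEuclideanCLM (n := Fin d) (𝕜 := ℝ) S w) /
      ((N / K : ℕ) * R ^ 2)))

lemma measurable_compensatedExceedances {O : Finset (Fin N)} (μ : EuclideanSpace ℝ (Fin d))
    (S : Matrix (Fin d) (Fin d) ℝ) (R : ℝ) (b : BlockSplit N K) :
    Measurable fun p : ({i // i ∉ O} → EuclideanSpace ℝ (Fin d)) × EuclideanSpace ℝ (Fin d) =>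
      compensatedExceedances μ S R b p.1 p.2 := by
  have := measurable_exceedances (O := O) μ R b
  unfold compensatedExceedances
  fun_prop

/-- The Poisson-type bound on the exponential moment of the number of exceedances in a fixed
direction: given a bound `q` on the probability of each exceedance, it comes from
`1 + (e - 1) q ≤ exp ((e - 1) q)` and the independence of the blocks. -/
lemma ContaminatedSample.lintegral_exp_exceedances_le (hX : ContaminatedSample P X O μ S)
    (b : BlockSplit N K) {R : ℝ} (hR : 0 ≤ R) (hR0 : R = 0 → S = 0) (hS : S.PosSemidef)
    (w : EuclideanSpace ℝ (Fin d)) :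
    ∫⁻ ω, ENNReal.ofReal (Real.exp
      (compensatedExceedances μ S R b (fun i : {i // i ∉ O} => X i ω) w)) ∂P ≤ 1 := by
  set q := inner ℝ w (Matrix.toEuclideanCLM (n := Fin d) (𝕜 := ℝ) S w) /
        ((N / K : ℕ) * R ^ 2) with hq
  have hq0 : 0 ≤ q := by
    have := hS.inner_toEuclideanCLM_nonneg w
    positivity
  have he : 0 ≤ Real.exp 1 - 1 := by linarith [Real.add_one_le_exp 1]
  have hXm : ∀ i : {i // i ∉ O}, Measurable (X i) := fun i => hX.measurable i i.2
  let g : Fin K → ({i // i ∉ O} → EuclideanSpace ℝ (Fin d)) → ENNReal := fun k x =>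
    if R < |inner ℝ (cleanMean μ b x k) w| then ENNReal.ofReal (Real.exp 1) else 1
  have hg : ∀ k, Measurable (g k) := fun k => by
    have := measurable_cleanMean (O := O) μ b k
    exact Measurable.ite (measurableSet_lt (by fun_prop) (by fun_prop)) (by fun_prop) (by fun_prop)
  have hgS : ∀ k, DependsOn (g k) ((b.block k).subtype (· ∉ O) : Finset _) := fun k x y h => by
    have hz : cleanMean μ b x k = cleanMean μ b y k := by
      simp only [cleanMean]
      rw [Finset.sum_congr rfl fun i hi => by rw [h i hi]]
    simp only [g, hz]
  have hdisj : Pairwise fun k l =>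
      Disjoint ((b.block k).subtype (· ∉ O)) ((b.block l).subtype (· ∉ O)) := fun k l hkl => by
    refine Finset.disjoint_left.2 fun i hi hj => ?_
    exact Finset.disjoint_left.1 (b.disjoint hkl) (Finset.mem_subtype.1 hi)
      (Finset.mem_subtype.1 hj)
  have hgi : ∀ k, ∫⁻ ω, g k (fun i => X i ω) ∂P ≤
      ENNReal.ofReal (Real.exp ((Real.exp 1 - 1) * q)) := fun k => by
    set D := {ω | R < |inner ℝ (cleanMean μ b (fun i : {i // i ∉ O} => X i ω) k) w|} with hD
    have hDm : MeasurableSet D := by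
      have := (measurable_cleanMean (O := O) μ b k).comp (measurable_pi_lambda _ hXm)
      exact measurableSet_lt measurable_const (by
        simpa only [Function.comp_def] using (this.inner_const (c := w)).abs)
    calc ∫⁻ ω, g k (fun i => X i ω) ∂P
        = ∫⁻ ω, (1 + D.indicator (fun _ => ENNReal.ofReal (Real.exp 1 - 1)) ω) ∂P := by
          refine lintegral_congr fun ω => ?_
          by_cases h : ω ∈ D
          · have h' : R < |inner ℝ (cleanMean μ b (fun i : {i // i ∉ O} => X i ω) k) w| := h
            rw [Set.indicator_of_mem h, ← ENNReal.ofReal_one, ← ENNReal.ofReal_add zero_le_one he]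
            simp only [g, if_pos h']
            congr 1
            ring
          · have h' : ¬ R < |inner ℝ (cleanMean μ b (fun i : {i // i ∉ O} => X i ω) k) w| := h
            rw [Set.indicator_of_notMem h]
            simp only [g, if_neg h', add_zero]
      _ = 1 + ENNReal.ofReal (Real.exp 1 - 1) * P D := by
          rw [lintegral_add_left measurable_const, lintegral_indicator_const hDm]
          simp
      _ ≤ 1 + ENNReal.ofReal (Real.exp 1 - 1) * ENNReal.ofReal q := by
          gcongr
          exact hX.measure_cleanMean_large_le b k hR hR0 hS w
      _ = ENNReal.ofReal ((Real.exp 1 - 1) * q + 1) := by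
          rw [← ENNReal.ofReal_mul he, add_comm, ENNReal.ofReal_add (by positivity) zero_le_one,
            ENNReal.ofReal_one]
      _ ≤ _ := ENNReal.ofReal_le_ofReal (Real.add_one_le_exp _)
  calc _ = ∫⁻ ω, ENNReal.ofReal (Real.exp (-(K * ((Real.exp 1 - 1) * q)))) *
          ∏ k, g k (fun i => X i ω) ∂P := by
        refine lintegral_congr fun ω => ?_
        rw [compensatedExceedances, ← hq, sub_eq_neg_add, Real.exp_add, ENNReal.ofReal_mul (Real.exp_nonneg _), exceedances,
          Real.exp_sum, ENNReal.ofReal_prod_of_nonneg fun _ _ => Real.exp_nonneg _]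
        congr 1
        refine Finset.prod_congr rfl fun k _ => ?_
        simp only [g]
        split_ifs <;> simp
    _ = ENNReal.ofReal (Real.exp (-(K * ((Real.exp 1 - 1) * q)))) *
          ∏ k, ∫⁻ ω, g k (fun i => X i ω) ∂P := by
        rw [lintegral_const_mul' _ _ ENNReal.ofReal_ne_top,
          lintegral_prod_of_dependsOn hX.indep hXm hdisj hg hgS]
    _ ≤ ENNReal.ofReal (Real.exp (-(K * ((Real.exp 1 - 1) * q)))) *
          ∏ _k : Fin K, ENNReal.ofReal (Real.exp ((Real.exp 1 - 1) * q)) := by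
        gcongr with k
        exact hgi k
    _ = 1 := by
        rw [Finset.prod_const, Finset.card_univ, Fintype.card_fin,
          ← ENNReal.ofReal_pow (Real.exp_nonneg _), ← ENNReal.ofReal_mul (Real.exp_nonneg _),
          ← Real.exp_nat_mul, ← Real.exp_add]
        simp

/-- The exponential moment, under the Gaussian prior on directions, of the compensated number of
exceedances. -/
noncomputable def gaussianMoment {O : Finset (Fin N)} (μ : EuclideanSpace ℝ (Fin d))
    (S : Matrix (Fin d) (Fin d) ℝ) (R : ℝ) (b : BlockSplit N K)
    (x : {i // i ∉ O} → EuclideanSpace ℝ (Fin d)) : ENNReal :=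
  ∫⁻ w, ENNReal.ofReal (Real.exp (compensatedExceedances μ S R b x w))
    ∂(stdGaussian (EuclideanSpace ℝ (Fin d)))

lemma measurable_gaussianMoment {O : Finset (Fin N)} (μ : EuclideanSpace ℝ (Fin d))
    (S : Matrix (Fin d) (Fin d) ℝ) (R : ℝ) :
    Measurable fun p : BlockSplit N K × ({i // i ∉ O} → EuclideanSpace ℝ (Fin d)) =>
      gaussianMoment μ S R p.1 p.2 := by
  have : MeasurableSingletonClass (BlockSplit N K) := ⟨fun _ => trivial⟩
  exact measurable_from_prod_countable_right fun b =>
    (measurable_compensatedExceedances μ S R b).exp.ennreal_ofReal.lintegral_prod_right'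

lemma ContaminatedSample.lintegral_gaussianMoment_const_le (hX : ContaminatedSample P X O μ S)
    (b : BlockSplit N K) {R : ℝ} (hR : 0 ≤ R) (hR0 : R = 0 → S = 0) (hS : S.PosSemidef) :
    ∫⁻ ω, gaussianMoment μ S R b (fun i : {i // i ∉ O} => X i ω) ∂P ≤ 1 := by
  have hXm : Measurable fun ω (i : {i // i ∉ O}) => X i ω :=
    measurable_pi_lambda _ fun i => hX.measurable i i.2
  have hm : Measurable fun p : Ω × EuclideanSpace ℝ (Fin d) => ENNReal.ofReal (Real.exp
      (compensatedExceedances μ S R b (fun i : {i // i ∉ O} => X i p.1) p.2)) :=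
    ((measurable_compensatedExceedances (O := O) μ S R b).comp
      ((hXm.comp measurable_fst).prodMk measurable_snd)).exp.ennreal_ofReal
  calc _ = ∫⁻ w, ∫⁻ ω, ENNReal.ofReal (Real.exp
            (compensatedExceedances μ S R b (fun i : {i // i ∉ O} => X i ω) w)) ∂P
          ∂(stdGaussian (EuclideanSpace ℝ (Fin d))) := lintegral_lintegral_swap hm.aemeasurable
    _ ≤ ∫⁻ _, 1 ∂(stdGaussian (EuclideanSpace ℝ (Fin d))) :=
        lintegral_mono fun w => hX.lintegral_exp_exceedances_le b hR hR0 hS w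
    _ = 1 := by simp

/-- The bound for a random split follows from that for deterministic ones by conditioning on the
split. -/
lemma ContaminatedSample.lintegral_gaussianMoment_le (hX : ContaminatedSample P X O μ S)
    {B : Ω → BlockSplit N K} (hB : Measurable B)
    (hBX : IndepFun B (fun ω (i : {i // i ∉ O}) => X i ω) P)
    {R : ℝ} (hR : 0 ≤ R) (hR0 : R = 0 → S = 0) (hS : S.PosSemidef) :
    ∫⁻ ω, gaussianMoment μ S R (B ω) (fun i : {i // i ∉ O} => X i ω) ∂P ≤ 1 := by
  have hXm : Measurable fun ω (i : {i // i ∉ O}) => X i ω :=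
    measurable_pi_lambda _ fun i => hX.measurable i i.2
  -- Only the measurability of `G` and the bound for each fixed split matter from here on.
  generalize hGdef : (fun p : BlockSplit N K × ({i // i ∉ O} → EuclideanSpace ℝ (Fin d)) =>
    gaussianMoment μ S R p.1 p.2) = G
  have hG : Measurable G := hGdef ▸ measurable_gaussianMoment μ S R
  have hGb : ∀ b, ∫⁻ ω, G (b, fun i => X i ω) ∂P ≤ 1 := fun b =>
    hGdef ▸ hX.lintegral_gaussianMoment_const_le b hR hR0 hS
  have hPB := Measure.isProbabilityMeasure_map (μ := P) hB.aemeasurable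
  have hPX := Measure.isProbabilityMeasure_map (μ := P) hXm.aemeasurable
  have h1 := (indepFun_iff_map_prod_eq_prod_map_map hB.aemeasurable hXm.aemeasurable).1 hBX
  calc _ = ∫⁻ ω, G (B ω, fun i => X i ω) ∂P := by rw [← hGdef]
    _ = ∫⁻ p, G p ∂(P.map fun ω => (B ω, fun i : {i // i ∉ O} => X i ω)) :=
        (lintegral_map hG (hB.prodMk hXm)).symm
    _ = ∫⁻ b, ∫⁻ x, G (b, x) ∂(P.map fun ω (i : {i // i ∉ O}) => X i ω) ∂(P.map B) := by
        rw [h1, lintegral_prod _ hG.aemeasurable]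
    _ ≤ ∫⁻ _, 1 ∂(P.map B) := lintegral_mono fun b =>
        (lintegral_map (hG.comp measurable_prodMk_left) hXm).trans_le (hGb b)
    _ = 1 := by simp

end Blocks

/-! ### Bounds uniform over directions and over density matrices -/

section Directions

variable {N K d : ℕ} {O : Finset (Fin N)} {μ : EuclideanSpace ℝ (Fin d)}
  {S : Matrix (Fin d) (Fin d) ℝ}

lemma rate_nonneg (N K : ℕ) (S : Matrix (Fin d) (Fin d) ℝ) : 0 ≤ rate N K S := by
  unfold rate; positivity

lemma trace_le_rate_sq (hN : 0 < N) (K : ℕ) (hS : S.PosSemidef) :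
    1200 ^ 2 * S.trace ≤ N * rate N K S ^ 2 := by
  have ht : 0 ≤ S.trace := hS.trace_nonneg
  have hN' : (0 : ℝ) < N := by exact_mod_cast hN
  have h : (1200 * √(S.trace / N)) ^ 2 ≤ rate N K S ^ 2 := by
    refine pow_le_pow_left₀ (by positivity) ?_ 2
    rw [rate]
    exact le_add_of_nonneg_right (Real.sqrt_nonneg _)
  rw [mul_pow, Real.sq_sqrt (by positivity)] at h
  calc 1200 ^ 2 * S.trace = N * (1200 ^ 2 * (S.trace / N)) := by field_simp
    _ ≤ _ := by gcongr

lemma norm_le_rate_sq (hN : 0 < N) (K : ℕ) (S : Matrix (Fin d) (Fin d) ℝ) :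
    1200 * ‖Matrix.toEuclideanCLM (n := Fin d) (𝕜 := ℝ) S‖ * K ≤ N * rate N K S ^ 2 := by
  have hN' : (0 : ℝ) < N := by exact_mod_cast hN
  have h : √(1200 * ‖Matrix.toEuclideanCLM (n := Fin d) (𝕜 := ℝ) S‖ * K / N) ^ 2 ≤
      rate N K S ^ 2 := by
    refine pow_le_pow_left₀ (by positivity) ?_ 2
    rw [rate]
    exact le_add_of_nonneg_left (by positivity)
  rw [Real.sq_sqrt (by positivity), div_le_iff₀ hN'] at h
  linarith

lemma eq_zero_of_rate_eq_zero (hN : 0 < N) (hS : S.PosSemidef) (h : rate N K S = 0) : S = 0 := by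
  have h1 := trace_le_rate_sq hN K hS
  rw [h] at h1
  exact hS.trace_eq_zero_iff.1 (le_antisymm (by linarith) hS.trace_nonneg)

/-- On the event that the Gaussian moment is small, in every direction at most `K / 90` blocks have
a clean mean exceeding `r`. This is the PAC-Bayes inequality for the translates by `√β v`, where
`β = K / 500` balances the divergence `β / 2` against the variance `Tr S / β` that the perturbation
adds. -/
lemma card_cleanMean_large_le (hK : 1 ≤ K) (hKN : K ≤ N) (hS : S.PosSemidef)
    (b : BlockSplit N K) (x : {i // i ∉ O} → EuclideanSpace ℝ (Fin d))
    (hx : gaussianMoment μ S (√(K / 500) * rate N K S) b x ≤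
      ENNReal.ofReal (Real.exp (K / 180000)))
    {v : EuclideanSpace ℝ (Fin d)} (hv : ‖v‖ = 1) :
    ((Finset.univ.filter fun k => rate N K S < |inner ℝ (cleanMean μ b x k) v|).card : ℝ) ≤
      K / 90 := by
  set r := rate N K S with hr
  set β : ℝ := K / 500 with hβ
  have hK0 : (0 : ℝ) < K := by exact_mod_cast hK
  have hN : 0 < N := by omega
  have hN0 : (0 : ℝ) < N := by exact_mod_cast hN
  have hβ0 : 0 < β := by positivity
  have hβs : √β ^ 2 = β := Real.sq_sqrt hβ0.le
  obtain ⟨R, hR⟩ : ∃ R, R = √β * r := ⟨_, rfl⟩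
  rw [← hR] at hx
  set u := √β • v with hu
  set T := Matrix.toEuclideanCLM (n := Fin d) (𝕜 := ℝ) S with hT
  set m : ℝ := ((N / K : ℕ) : ℝ) with hm
  have hm1 : 1 ≤ N / K := (Nat.one_le_div_iff (by omega)).2 hKN
  have hm0 : 0 < m := Nat.cast_pos.2 hm1
  have hNm : (N : ℝ) ≤ 2 * K * m := by
    have h1 : N < K * (N / K + 1) := Nat.lt_mul_div_succ N (by omega)
    have h2 : N ≤ 2 * K * (N / K) := by nlinarith
    rw [hm]
    exact_mod_cast h2
  have hind : ∀ k, Integrable (fun g => if R < |inner ℝ (cleanMean μ b x k) (g + u)|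
      then (1 : ℝ) else 0) (stdGaussian (EuclideanSpace ℝ (Fin d))) := fun k =>
    integrable_indicator_inner _ _ _
  have hexi : Integrable (fun g => exceedances μ R b x (g + u))
      (stdGaussian (EuclideanSpace ℝ (Fin d))) := integrable_finsetSum _ fun k _ => hind k
  have hqi : Integrable (fun g => K * ((Real.exp 1 - 1) *
      (inner ℝ (g + u) (T (g + u)) / (m * R ^ 2))))
      (stdGaussian (EuclideanSpace ℝ (Fin d))) :=
    (((integrable_quadratic_shift S u).div_const _).const_mul _).const_mul _
  have hmeas := (measurable_compensatedExceedances (O := O) μ S R b).comp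
    (measurable_prodMk_left (x := x))
  change Measurable fun w => compensatedExceedances μ S R b x w at hmeas
  have hpac := integral_shift_le_of_lintegral_exp_le hmeas hx u (hexi.sub hqi)
  simp only [compensatedExceedances, ← hT, ← hm] at hpac
  rw [integral_sub hexi hqi, integral_const_mul, integral_const_mul, integral_div,
    integral_quadratic_shift, ← hT] at hpac
  -- Each block exceeding `r` in the direction `v` contributes at least one half.
  have hcount : (1 / 2 : ℝ) *
      ((Finset.univ.filter fun k => r < |inner ℝ (cleanMean μ b x k) v|).card : ℝ) ≤
      ∫ g, exceedances μ R b x (g + u) ∂(stdGaussian (EuclideanSpace ℝ (Fin d))) := by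
    simp only [exceedances]
    rw [integral_finsetSum _ fun k _ => hind k, mul_comm, ← nsmul_eq_mul, ← Finset.sum_const,
      Finset.sum_filter]
    refine Finset.sum_le_sum fun k _ => ?_
    split_ifs with h
    · refine half_le_integral_indicator ?_
      rw [hu, inner_smul_right, abs_mul, abs_of_pos (Real.sqrt_pos.2 hβ0), hR]
      exact mul_lt_mul_of_pos_left h (Real.sqrt_pos.2 hβ0)
    · exact integral_nonneg fun g => by positivity
  have hunorm : ‖u‖ ^ 2 = β := by
    rw [hu, norm_smul, hv, mul_one, Real.norm_of_nonneg (Real.sqrt_nonneg _), hβs]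
  have hquad : inner ℝ u (T u) ≤ β * ‖T‖ := by
    calc inner ℝ u (T u) ≤ ‖u‖ * ‖T u‖ := real_inner_le_norm _ _
      _ ≤ ‖u‖ * (‖T‖ * ‖u‖) := by gcongr; exact T.le_opNorm u
      _ = β * ‖T‖ := by rw [← hunorm]; ring
  have htr := trace_le_rate_sq hN K hS
  have hop := norm_le_rate_sq hN K S
  rw [← hr] at htr hop
  have hq : (S.trace + inner ℝ u (T u)) / (m * R ^ 2) ≤ 1 / 600 + 1 / 1440 := by
    refine div_le_of_le_mul₀ (by positivity) (by norm_num) ?_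
    have hR2 : m * R ^ 2 = β * (m * r ^ 2) := by rw [hR, mul_pow, hβs]; ring
    have hNr : N * r ^ 2 ≤ 2 * K * (m * r ^ 2) := by
      calc N * r ^ 2 ≤ (2 * K * m) * r ^ 2 := by gcongr
        _ = _ := by ring
    have h1 : ‖T‖ ≤ 1 / 600 * (m * r ^ 2) := by
      have : K * (1200 * ‖T‖) ≤ K * (2 * (m * r ^ 2)) := by linarith
      have := le_of_mul_le_mul_left this hK0
      linarith
    have h2 : S.trace ≤ 1 / 1440 * (β * (m * r ^ 2)) := by
      rw [hβ]; linarith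
    rw [hR2]
    have h3 : β * ‖T‖ ≤ β * (1 / 600 * (m * r ^ 2)) := by gcongr
    linarith
  have he : Real.exp 1 - 1 ≤ 1.72 := by linarith [Real.exp_one_lt_d9]
  have he0 : 0 ≤ Real.exp 1 - 1 := by linarith [Real.add_one_le_exp 1]
  have hq0 : 0 ≤ (S.trace + inner ℝ u (T u)) / (m * R ^ 2) :=
    div_nonneg (add_nonneg hS.trace_nonneg (hS.inner_toEuclideanCLM_nonneg u)) (by positivity)
  have hcomp : K * ((Real.exp 1 - 1) * ((S.trace + inner ℝ u (T u)) / (m * R ^ 2))) ≤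
      K * (1.72 * (1 / 600 + 1 / 1440)) := by
    gcongr
  -- Half the count is at most `K (1.72 (1 / 600 + 1 / 1440) + 1 / 1000 + 1 / 180000)`, which is
  -- less than `K / 180`.
  rw [hunorm] at hpac
  linarith

/-- The deterministic part of the argument: on the event that the Gaussian moment is small, the
blocks are good, whatever the outliers are. -/
lemma goodBlocks_of_gaussianMoment_le (hK : 1 ≤ K) (hKN : K ≤ N) (hS : S.PosSemidef)
    (hKO : 300 * O.card ≤ K) (b : BlockSplit N K) (x : Fin N → EuclideanSpace ℝ (Fin d))
    (hx : gaussianMoment μ S (√(K / 500) * rate N K S) b (fun i : {i // i ∉ O} => x i) ≤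
      ENNReal.ofReal (Real.exp (K / 180000))) :
    GoodBlocks b x μ (rate N K S) := by
  classical
  intro M hM htr
  set r := rate N K S with hr
  have hm : 0 < N / K := Nat.div_pos hKN hK
  set large := Finset.univ.filter fun k => 8 * r <
    ‖Matrix.toEuclideanCLM (n := Fin d) (𝕜 := ℝ) (CFC.sqrt M) (blockMean b x k - μ)‖ with hlarge
  have h1 : 3 / 10 * (large.card : ℝ) ≤ K / 90 + K / 300 := by
    refine card_norm_sqrt_large_le hM htr (fun k => blockMean b x k - μ) (rate_nonneg N K S)
      fun v hv => ?_
    have hsub : (Finset.univ.filter fun k => r < |inner ℝ (blockMean b x k - μ) v|) ⊆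
        (Finset.univ.filter fun k =>
          r < |inner ℝ (cleanMean μ b (fun i : {i // i ∉ O} => x i) k) v|) ∪
        Finset.univ.filter fun k => ¬ Disjoint (b.block k) O := by
      intro k hk
      by_cases hd : Disjoint (b.block k) O
      · rw [Finset.mem_filter, blockMean_sub_eq_cleanMean μ b x hm hd] at hk
        exact Finset.mem_union_left _ (Finset.mem_filter.2 hk)
      · exact Finset.mem_union_right _ (Finset.mem_filter.2 ⟨Finset.mem_univ _, hd⟩)
    have h2 : ((Finset.univ.filter fun k => r < |inner ℝ (blockMean b x k - μ) v|).card : ℝ) ≤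
        ((Finset.univ.filter fun k =>
          r < |inner ℝ (cleanMean μ b (fun i : {i // i ∉ O} => x i) k) v|).card : ℝ) +
        O.card := by
      exact_mod_cast ((Finset.card_le_card hsub).trans (Finset.card_union_le _ _)).trans
        (Nat.add_le_add_left (card_not_disjoint_le b O) _)
    have h3 : (300 : ℝ) * O.card ≤ K := by exact_mod_cast hKO
    have h4 := card_cleanMean_large_le hK hKN hS b _ hx hv
    linarith
  have hset : {k : Fin K | ‖Matrix.toEuclideanCLM (n := Fin d) (𝕜 := ℝ) (CFC.sqrt M)
      (blockMean b x k - μ)‖ ≤ 8 * r} = ((largeᶜ : Finset (Fin K)) : Set (Fin K)) := by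
    ext k
    simp [hlarge]
  rw [hset, Set.ncard_coe_finset]
  have h5 : (large.card : ℝ) + (largeᶜ.card : ℝ) = K := by
    exact_mod_cast (Finset.card_add_card_compl large).trans (Fintype.card_fin K)
  have : (0 : ℝ) ≤ K := by positivity
  linarith

end Directions

theorem proposition1 {Ω : Type*} [MeasurableSpace Ω] (P : Measure Ω) [IsProbabilityMeasure P]
    (N K d : ℕ) (hK : 1 ≤ K) (hKN : K ≤ N)
    (X : Fin N → Ω → EuclideanSpace ℝ (Fin d)) (O : Finset (Fin N))
    (μ : EuclideanSpace ℝ (Fin d)) (S : Matrix (Fin d) (Fin d) ℝ) (hS : S.PosSemidef)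
    (hX : ContaminatedSample P X O μ S)
    (B : Ω → BlockSplit N K) (hB : Measurable B)
    (hBX : IndepFun B (fun ω (i : {i // i ∉ O}) => X i ω) P)
    (hKO : 300 * O.card ≤ K) :
    ∃ A : Set Ω, MeasurableSet A ∧
      A ⊆ {ω | GoodBlocks (B ω) (fun i => X i ω) μ (rate N K S)} ∧
      1 - Real.exp (-(K : ℝ) / 180000) ≤ P.real A := by
  have hK0 : (0 : ℝ) < K := by exact_mod_cast hK
  obtain ⟨R, hRdef⟩ : ∃ R, R = √(K / 500) * rate N K S := ⟨_, rfl⟩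
  have hR : 0 ≤ R := hRdef ▸ mul_nonneg (Real.sqrt_nonneg _) (rate_nonneg N K S)
  have hR0 : R = 0 → S = 0 := fun h => by
    rcases mul_eq_zero.1 (hRdef ▸ h) with h | h
    · exact absurd h (Real.sqrt_pos.2 (by positivity)).ne'
    · exact eq_zero_of_rate_eq_zero (by omega) hS h
  let G : Ω → ENNReal := fun ω =>
    gaussianMoment μ S R (B ω) (fun i : {i // i ∉ O} => X i ω)
  have hXm : Measurable fun ω (i : {i // i ∉ O}) => X i ω :=
    measurable_pi_lambda _ fun i => hX.measurable i i.2
  have hG := (measurable_gaussianMoment (K := K) (O := O) μ S R).comp (hB.prodMk hXm)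
  change Measurable G at hG
  have hint : ∫⁻ ω, G ω ∂P ≤ 1 := hX.lintegral_gaussianMoment_le hB hBX hR hR0 hS
  set A := {ω | G ω ≤ ENNReal.ofReal (Real.exp (K / 180000))} with hA
  have hAm : MeasurableSet A := measurableSet_le hG measurable_const
  refine ⟨A, hAm, fun ω hω => ?_, ?_⟩
  · have hω' : G ω ≤ ENNReal.ofReal (Real.exp (K / 180000)) := hω
    simp only [G, hRdef] at hω'
    exact goodBlocks_of_gaussianMoment_le hK hKN hS hKO (B ω) (fun i => X i ω) hω'
  have hc : P Aᶜ ≤ ENNReal.ofReal (Real.exp (-(K : ℝ) / 180000)) := by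
    calc P Aᶜ ≤ P {ω | ENNReal.ofReal (Real.exp (K / 180000)) ≤ G ω} :=
          by
          refine measure_mono ?_
          intro ω (hω : ¬ G ω ≤ _)
          exact (not_le.1 hω).le
      _ ≤ (∫⁻ ω, G ω ∂P) / ENNReal.ofReal (Real.exp (K / 180000)) :=
          meas_ge_le_lintegral_div hG.aemeasurable
            (ENNReal.ofReal_pos.2 (Real.exp_pos _)).ne' ENNReal.ofReal_ne_top
      _ ≤ 1 / ENNReal.ofReal (Real.exp (K / 180000)) := by gcongr
      _ = _ := by
          rw [one_div, ← ENNReal.ofReal_inv_of_pos (Real.exp_pos _), ← Real.exp_neg, neg_div]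
  have h1 := probReal_compl_eq_one_sub (μ := P) hAm
  have h2 : P.real Aᶜ ≤ Real.exp (-(K : ℝ) / 180000) :=
    ENNReal.toReal_le_of_le_ofReal (Real.exp_nonneg _) hc
  linarith
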